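/- Let $\mathcal H$ be an infinite-dimensional complex Hilbert space, let $q$ be a positive integer, and let ${\bf A}=(A_1,\dots,A_m)$ be an $m$-tuple of bounded self-adjoint operators on $\mathcal H$. For an $m$-tuple ${\bf T}=(T_1,\dots,T_m)$ of bounded operators on $\mathcal H$ let $$W(q:{\bf T})=\{(X^*T_1X,\dots,X^*T_mX)\;:\; X:\mathbb C^q\to\mathcal H \text{ linear},\ X^*X=I_q\}\subseteq {\bf M}_q^m,$$ where ${\bf M}_q$ is the space of complex $q\times q$ matrices, and let $$W_{ess}(q:{\bf A})=\bigcap\{{\bf cl}(W(q:{\bf A}+{\bf F}))\;:\;{\bf F}=(F_1,\dots,F_m),\ F_1,\dots,F_m \text{ bounded finite-rank operators on }\mathcal H\},$$ where ${\bf cl}$ denotes the closure in ${\bf M}_q^m$ and the $F_j$ need not be self-adjoint. Then $$W_{ess}(q:{\bf A})=\bigcap\{{\bf cl}(W(q:{\bf A}+{\bf G}))\;:\;{\bf G}=(G_1,\dots,G_m),\ G_1,\dots,G_m \text{ compact self-adjoint operators on }\mathcal H\}.$$ -/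

import Mathlib

namespace MatricialRange

noncomputable section

variable {H : Type*} [NormedAddCommGroup H] [InnerProductSpace ℂ H] [CompleteSpace H]

/-- The joint `q`-matricial range `W(q : A)` of an `m`-tuple `A`: all tuples
`(X* A₁ X, …, X* A_m X)` of `q × q` matrices with `X* X = I`. The `q`-dimensional domain of the
isometry `X` is identified with `ℂ^q`, and an operator on `ℂ^q` with its matrix in the
standard basis. -/
def jointRange (q : ℕ) {m : ℕ} (A : Fin m → (H →L[ℂ] H)) :
    Set (Fin m → Matrix (Fin q) (Fin q) ℂ) :=
  {B | ∃ X : EuclideanSpace ℂ (Fin q) →L[ℂ] H,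
    ContinuousLinearMap.adjoint X ∘L X = ContinuousLinearMap.id ℂ _ ∧
    ∀ j, Matrix.toEuclideanCLM (n := Fin q) (𝕜 := ℂ) (B j) =
      ContinuousLinearMap.adjoint X ∘L A j ∘L X}

/-- The joint essential `q`-matricial range: the intersection of the closures of
`W(q : A + F)` over all `m`-tuples `F` of (not necessarily self-adjoint) finite rank operators. -/
def essRange (q : ℕ) {m : ℕ} (A : Fin m → (H →L[ℂ] H)) :
    Set (Fin m → Matrix (Fin q) (Fin q) ℂ) :=
  ⋂ F ∈ {F : Fin m → (H →L[ℂ] H) | ∀ j, (F j).toLinearMap.HasFiniteRange}, closure (jointRange q (A + F))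

end

end MatricialRange

namespace MatricialRange

open scoped InnerProductSpace ComplexConjugate

section

variable {H : Type*} [NormedAddCommGroup H] [InnerProductSpace ℂ H]

/-! One inclusion holds because compact operators are norm limits of finite rank ones
(`essRange_subset`). For the other, given finite rank `F`, let `K` be the span of the ranges of the
`F j` and `P` the projection onto `K`. Pick `y` in the joint essential numerical range of `A`. The
self-adjoint compact perturbation taking `A j` to `(1 - P) A j (1 - P) + y j P` decouples `K` and
makes `A j` scalar there. Vectors far out in `Kᗮ`, on which the `A j` are diagonal and nearly `y j`,
imitate that scalar block. So any orthonormal family can be moved into `Kᗮ`, nearly keeping its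
compressions (`exists_orthonormal_mem_orthogonal`), and there the `F j` contribute nothing. -/

theorem mem_closure_pi_iff {ι κ μ : Type*} [Fintype ι] [Fintype κ] [Fintype μ]
    {S : Set (ι → κ → μ → ℂ)} {B : ι → κ → μ → ℂ} :
    B ∈ closure S ↔ ∀ ε > 0, ∃ C ∈ S, ∀ j k l, ‖B j k l - C j k l‖ < ε := by
  rw [Metric.mem_closure_iff]
  refine forall₂_congr fun ε hε => exists_congr fun C => and_congr_right fun _ => ?_
  simp only [dist_pi_lt_iff hε]
  simp only [dist_eq_norm]

/-- A compact operator with values in a Hilbert space is a norm limit of finite rank operators. -/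
theorem exists_hasFiniteRange_norm_sub_le {G : H →L[ℂ] H} (hG : IsCompactOperator G)
    {ε : ℝ} (hε : 0 < ε) :
    ∃ F : H →L[ℂ] H, F.toLinearMap.HasFiniteRange ∧ ‖G - F‖ ≤ ε := by
  have htb : TotallyBounded (G '' Metric.closedBall 0 1) := by
    obtain ⟨K, hK, hsub⟩ := IsCompactOperator.image_closedBall_subset_compact
      (f := G.toLinearMap) hG 1
    exact hK.totallyBounded.subset hsub
  obtain ⟨t, ht, hcover⟩ := Metric.totallyBounded_iff.1 htb ε hε
  -- Projecting onto the span of an `ε`-net moves a point no farther than its distance to the net.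
  let K := Submodule.span ℂ t
  have : FiniteDimensional ℂ K := FiniteDimensional.span_of_finite ℂ ht
  refine ⟨K.starProjection ∘L G, ?_, ?_⟩
  · have hK : K.starProjection.toLinearMap.HasFiniteRange := by
      rw [LinearMap.hasFiniteRange_iff_range]
      rw [show K.starProjection.toLinearMap.range = K from Submodule.range_starProjection K]
      exact Module.Finite.iff_fg.1 inferInstance
    exact hK.comp_right _
  · refine ContinuousLinearMap.opNorm_le_of_unit_norm hε.le fun v hv => ?_
    obtain ⟨z, hz, hvz⟩ := Set.mem_iUnion₂.1
      (hcover ⟨v, by simp [hv], rfl⟩)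
    have hmin := K.starProjection_minimal (G v)
    have hle : ‖G v - K.starProjection (G v)‖ ≤ ‖G v - z‖ := by
      rw [hmin]
      exact ciInf_le ⟨0, by rintro _ ⟨w, rfl⟩; positivity⟩
        (⟨z, Submodule.subset_span hz⟩ : K)
    refine hle.trans ?_
    rw [← dist_eq_norm]
    exact (Metric.mem_ball.1 hvz).le

/-! ### The joint essential numerical range -/

theorem exists_norm_eq_one_mem_orthogonal (hH : ¬ FiniteDimensional ℂ H) (L : Submodule ℂ H)
    [FiniteDimensional ℂ L] : ∃ x ∈ Lᗮ, ‖x‖ = 1 := by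
  have hL : Lᗮ ≠ ⊥ := by
    intro h
    rw [Submodule.orthogonal_eq_bot_iff] at h
    subst h
    exact hH (Submodule.topEquiv.finiteDimensional (V := (⊤ : Submodule ℂ H)))
  obtain ⟨v, hv, hv0⟩ := Submodule.exists_mem_ne_zero_of_ne_bot hL
  refine ⟨((‖v‖⁻¹ : ℝ) : ℂ) • v, Lᗮ.smul_mem _ hv, ?_⟩
  rw [norm_smul, Complex.norm_real, norm_inv, norm_norm, inv_mul_cancel₀ (norm_ne_zero_iff.2 hv0)]

/-- A point in the joint essential numerical range: it is approximated by values of the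
quadratic forms on unit vectors orthogonal to any given finite-dimensional subspace. -/
theorem exists_essential_point (hH : ¬ FiniteDimensional ℂ H) {m : ℕ} (A : Fin m → (H →L[ℂ] H)) :
    ∃ y : Fin m → ℝ, ∀ L : Submodule ℂ H, FiniteDimensional ℂ L → ∀ ε > 0,
      ∃ x ∈ Lᗮ, ‖x‖ = 1 ∧ ∀ j, |(⟪x, A j x⟫_ℂ).re - y j| < ε := by
  let V (L : Submodule ℂ H) : Set (Fin m → ℝ) :=
    (fun x j => (⟪x, A j x⟫_ℂ).re) '' {x | x ∈ Lᗮ ∧ ‖x‖ = 1}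
  have V_anti {L L' : Submodule ℂ H} (h : L ≤ L') : V L' ⊆ V L :=
    Set.image_mono fun x hx => ⟨Submodule.orthogonal_le h hx.1, hx.2⟩
  have V_bdd (L) : V L ⊆ Set.univ.pi fun j => Set.Icc (-‖A j‖) ‖A j‖ := by
    rintro _ ⟨x, ⟨-, hx⟩, rfl⟩ j -
    rw [Set.mem_Icc, ← abs_le]
    refine (Complex.abs_re_le_norm _).trans ((norm_inner_le_norm _ _).trans ?_)
    simpa [hx] using (A j).le_opNorm x
  -- The sets `closure (V L)` are compact, nonempty and directed downwards, since `V` reverses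
  -- inclusions and finite-dimensional subspaces have finite-dimensional sums.
  obtain ⟨y, hy⟩ := IsCompact.nonempty_iInter_of_directed_nonempty_isCompact_isClosed
    (ι := {L : Submodule ℂ H // FiniteDimensional ℂ L}) (hι := ⟨⟨⊥, inferInstance⟩⟩)
    (fun L => closure (V L))
    (fun L L' => by
      have := L.2
      have := L'.2
      exact ⟨⟨L ⊔ L', inferInstance⟩, closure_mono (V_anti le_sup_left),
        closure_mono (V_anti le_sup_right)⟩)
    (fun L => by
      have := L.2
      obtain ⟨x, hx, hx1⟩ := exists_norm_eq_one_mem_orthogonal hH (L : Submodule ℂ H)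
      exact ⟨_, subset_closure ⟨x, ⟨hx, hx1⟩, rfl⟩⟩)
    (fun L => (isCompact_univ_pi fun j => isCompact_Icc).closure_of_subset (V_bdd L))
    (fun L => isClosed_closure)
  refine ⟨y, fun L hL ε hε => ?_⟩
  obtain ⟨_, ⟨x, ⟨hx, hx1⟩, rfl⟩, hd⟩ := Metric.mem_closure_iff.1 (Set.mem_iInter.1 hy ⟨L, hL⟩) ε hε
  refine ⟨x, hx, hx1, fun j => ?_⟩
  rw [dist_comm, dist_pi_lt_iff hε] at hd
  exact hd j

/-! ### Making an operator scalar on a finite-dimensional subspace -/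

/-- The operator `(1 - P) T (1 - P) + y P`, where `P` is the orthogonal projection onto `K`. -/
noncomputable def replaceCorner (K : Submodule ℂ H) [K.HasOrthogonalProjection] (y : ℝ)
    (T : H →L[ℂ] H) : H →L[ℂ] H :=
  (1 - K.starProjection) * T * (1 - K.starProjection) + (y : ℂ) • K.starProjection

theorem inner_replaceCorner (K : Submodule ℂ H) [K.HasOrthogonalProjection] (y : ℝ)
    (T : H →L[ℂ] H) (v w : H) :
    ⟪v, replaceCorner K y T w⟫_ℂ =
      ⟪v - K.starProjection v, T (w - K.starProjection w)⟫_ℂ +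
        y * ⟪K.starProjection v, K.starProjection w⟫_ℂ := by
  have h : ⟪K.starProjection v, K.starProjection w⟫_ℂ = ⟪v, K.starProjection w⟫_ℂ := by
    rw [K.inner_starProjection_left_eq_right,
      K.starProjection_eq_self_iff.2 (K.starProjection_apply_mem w)]
  rw [h]
  simp only [replaceCorner, add_apply, mul_apply_eq_comp, sub_apply, one_apply_eq_self,
    smul_apply, inner_add_right, inner_sub_right, inner_sub_left, inner_smul_right,
    K.inner_starProjection_left_eq_right, map_sub]

theorem isCompactOperator_starProjection (K : Submodule ℂ H) [FiniteDimensional ℂ K] :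
    IsCompactOperator K.starProjection := by
  have := FiniteDimensional.proper ℂ K
  have h := isCompactOperator_of_locallyCompactSpace_dom K.orthogonalProjectionOnto
  exact h.clm_comp K.subtypeL

/-- The difference equals `P (y - T) - (1 - P) T P`, and each term has the compact factor `P`. -/
theorem isCompactOperator_replaceCorner_sub (K : Submodule ℂ H) [FiniteDimensional ℂ K] (y : ℝ)
    (T : H →L[ℂ] H) : IsCompactOperator (replaceCorner K y T - T) := by
  have hP := isCompactOperator_starProjection K
  have h : replaceCorner K y T - T = K.starProjection ∘L ((y : ℂ) • 1 - T) -
      ((1 - K.starProjection) * T) ∘L K.starProjection := by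
    simp only [replaceCorner, ← ContinuousLinearMap.mul_def, mul_sub, sub_mul, mul_one, one_mul,
      mul_smul_comm]
    abel
  rw [h]
  have h₁ := hP.comp_clm ((y : ℂ) • 1 - T)
  have h₂ := hP.clm_comp ((1 - K.starProjection) * T)
  exact IsCompactOperator.sub h₁ h₂

/-! ### Matricial ranges through orthonormal families -/

variable [CompleteSpace H]

/-- `W(q : A)` described entrywise by orthonormal families of vectors. -/
theorem mem_jointRange_iff {q m : ℕ} {A : Fin m → (H →L[ℂ] H)}
    {B : Fin m → Matrix (Fin q) (Fin q) ℂ} :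
    B ∈ jointRange q A ↔
      ∃ x : Fin q → H, Orthonormal ℂ x ∧ ∀ j k l, B j k l = ⟪x k, A j (x l)⟫_ℂ := by
  let e := EuclideanSpace.basisFun (Fin q) ℂ
  have entry (M : Matrix (Fin q) (Fin q) ℂ) (k l : Fin q) :
      ⟪e k, Matrix.toEuclideanCLM (n := Fin q) (𝕜 := ℂ) M (e l)⟫_ℂ = M k l := by
    simp [e, EuclideanSpace.basisFun_apply, EuclideanSpace.inner_single_left]
  constructor
  · rintro ⟨X, hX, hB⟩
    have inner_map (v w) : ⟪X v, X w⟫_ℂ = ⟪v, w⟫_ℂ := by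
      calc ⟪X v, X w⟫_ℂ = ⟪v, ContinuousLinearMap.adjoint X (X w)⟫_ℂ :=
            (ContinuousLinearMap.adjoint_inner_right X v (X w)).symm
        _ = ⟪v, w⟫_ℂ := by
          rw [← ContinuousLinearMap.comp_apply, hX, ContinuousLinearMap.id_apply]
    refine ⟨fun k => X (e k), ?_, fun j k l => ?_⟩
    · rw [orthonormal_iff_ite]
      intro k l
      rw [inner_map]
      exact orthonormal_iff_ite.1 e.orthonormal k l
    · rw [← entry (B j) k l, hB j]
      exact ContinuousLinearMap.adjoint_inner_right X _ _
  · rintro ⟨x, hx, hB⟩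
    let X : EuclideanSpace ℂ (Fin q) →L[ℂ] H := (e.toBasis.constr ℂ x).toContinuousLinearMap
    have hXe (k) : X (e k) = x k := by
      have := e.toBasis.constr_basis ℂ x k
      rwa [e.coe_toBasis] at this
    have ext_basis {S T : EuclideanSpace ℂ (Fin q) →L[ℂ] EuclideanSpace ℂ (Fin q)}
        (h : ∀ k l, ⟪e k, S (e l)⟫_ℂ = ⟪e k, T (e l)⟫_ℂ) : S = T := by
      apply ContinuousLinearMap.coe_injective
      refine e.toBasis.ext fun l => ?_
      rw [e.coe_toBasis]
      refine InnerProductSpace.ext_inner_left_basis e.toBasis fun k => ?_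
      rw [e.coe_toBasis]
      exact h k l
    refine ⟨X, ext_basis fun k l => ?_, fun j => ext_basis fun k l => ?_⟩
    · rw [ContinuousLinearMap.comp_apply, ContinuousLinearMap.adjoint_inner_right, hXe, hXe,
        orthonormal_iff_ite.1 hx k l]
      exact (orthonormal_iff_ite.1 e.orthonormal k l).symm
    · rw [entry, hB, ContinuousLinearMap.comp_apply, ContinuousLinearMap.comp_apply,
        ContinuousLinearMap.adjoint_inner_right, hXe, hXe]

theorem mem_closure_jointRange_iff {q m : ℕ} {A : Fin m → (H →L[ℂ] H)}
    {B : Fin m → Matrix (Fin q) (Fin q) ℂ} :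
    B ∈ closure (jointRange q A) ↔ ∀ ε > 0, ∃ x : Fin q → H, Orthonormal ℂ x ∧
      ∀ j k l, ‖B j k l - ⟪x k, A j (x l)⟫_ℂ‖ < ε := by
  refine (mem_closure_pi_iff (S := jointRange q A) (B := B)).trans ?_
  refine forall₂_congr fun ε _ => ?_
  constructor
  · rintro ⟨C, hC, h⟩
    obtain ⟨x, hx, hCx⟩ := mem_jointRange_iff.1 hC
    exact ⟨x, hx, fun j k l => hCx j k l ▸ h j k l⟩
  · rintro ⟨x, hx, h⟩
    exact ⟨fun j k l => ⟪x k, A j (x l)⟫_ℂ, mem_jointRange_iff.2 ⟨x, hx, fun _ _ _ => rfl⟩, h⟩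

/-- An orthonormal sequence, orthogonal to a given finite-dimensional subspace, on which the
quadratic forms of the `A j` are diagonal and nearly constant. -/
theorem exists_orthonormal_diagonal {m : ℕ} {A : Fin m → (H →L[ℂ] H)}
    (hA : ∀ j, IsSelfAdjoint (A j)) {y : Fin m → ℝ}
    (hy : ∀ L : Submodule ℂ H, FiniteDimensional ℂ L → ∀ ε > 0,
      ∃ x ∈ Lᗮ, ‖x‖ = 1 ∧ ∀ j, |(⟪x, A j x⟫_ℂ).re - y j| < ε)
    (L : Submodule ℂ H) [FiniteDimensional ℂ L] {ε : ℝ} (hε : 0 < ε) :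
    ∃ f : ℕ → H, Orthonormal ℂ f ∧ (∀ n, f n ∈ Lᗮ) ∧
      (∀ n j, ‖⟪f n, A j (f n)⟫_ℂ - y j‖ < ε) ∧
      ∀ j i n, i ≠ n → ⟪f i, A j (f n)⟫_ℂ = 0 := by
  have hsymm (j) (v w : H) : ⟪A j v, w⟫_ℂ = ⟪v, A j w⟫_ℂ := (hA j).isSymmetric v w
  obtain ⟨f, hf, hfr⟩ := exists_seq_of_forall_finset_exists
    (fun x : H => x ∈ Lᗮ ∧ ‖x‖ = 1 ∧ ∀ j, |(⟪x, A j x⟫_ℂ).re - y j| < ε)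
    (fun x z => ⟪x, z⟫_ℂ = 0 ∧ ∀ j, ⟪A j x, z⟫_ℂ = 0) (fun s _ => by
      -- Orthogonality to the earlier vectors gives orthonormality; orthogonality to their images
      -- under the `A j` kills the off-diagonal entries on one side, and symmetry of `A j` handles
      -- the other.
      let t : Set H := s ∪ ⋃ j, A j '' s
      have ht : t.Finite :=
        s.finite_toSet.union (Set.finite_iUnion fun j => s.finite_toSet.image _)
      have := FiniteDimensional.span_of_finite ℂ ht
      obtain ⟨z, hz, hz1, hzA⟩ := hy (L ⊔ Submodule.span ℂ t) inferInstance ε hε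
      have hzt (w) (hw : w ∈ t) : ⟪w, z⟫_ℂ = 0 :=
        (Submodule.mem_orthogonal _ _).1 hz w (le_sup_right (a := L) (Submodule.subset_span hw))
      exact ⟨z, ⟨Submodule.orthogonal_le le_sup_left hz, hz1, hzA⟩, fun x hx =>
        ⟨hzt x (Or.inl hx), fun j => hzt _ (Or.inr (Set.mem_iUnion.2 ⟨j, x, hx, rfl⟩))⟩⟩)
  refine ⟨f, ⟨fun n => (hf n).2.1, fun i n hin => ?_⟩, fun n => (hf n).1, fun n j => ?_,
    fun j i n hin => ?_⟩
  · rcases lt_or_gt_of_ne hin with h | h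
    · exact (hfr _ _ h).1
    · exact inner_eq_zero_symm.1 (hfr _ _ h).1
  · have hreal : ⟪f n, A j (f n)⟫_ℂ = ((⟪f n, A j (f n)⟫_ℂ).re : ℂ) := by
      refine (Complex.conj_eq_iff_re.1 ?_).symm
      rw [inner_conj_symm, hsymm]
    rw [hreal, ← Complex.ofReal_sub, Complex.norm_real]
    exact (hf n).2.2 j
  · rcases lt_or_gt_of_ne hin with h | h
    · rw [← hsymm]
      exact (hfr _ _ h).2 j
    · exact inner_eq_zero_symm.1 ((hfr _ _ h).2 j)

theorem isSelfAdjoint_replaceCorner (K : Submodule ℂ H) [K.HasOrthogonalProjection] (y : ℝ)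
    {T : H →L[ℂ] H} (hT : IsSelfAdjoint T) : IsSelfAdjoint (replaceCorner K y T) := by
  have hP : IsSelfAdjoint K.starProjection := isSelfAdjoint_starProjection K
  have hQ : IsSelfAdjoint (1 - K.starProjection) := (IsSelfAdjoint.one _).sub hP
  refine IsSelfAdjoint.add ?_ (IsSelfAdjoint.smul (Complex.conj_ofReal y) hP)
  have := hT.conjugate (1 - K.starProjection)
  rwa [hQ.star_eq] at this

theorem essRange_subset (q : ℕ) {m : ℕ} (A : Fin m → (H →L[ℂ] H)) {G : Fin m → (H →L[ℂ] H)}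
    (hG : ∀ j, IsCompactOperator (G j)) : essRange q A ⊆ closure (jointRange q (A + G)) := by
  intro B hB
  rw [mem_closure_jointRange_iff]
  intro ε hε
  choose F hF hGF using fun j => exists_hasFiniteRange_norm_sub_le (hG j) (half_pos hε)
  obtain ⟨x, hx, hBx⟩ := mem_closure_jointRange_iff.1 (Set.mem_iInter₂.1 hB F hF) _ (half_pos hε)
  refine ⟨x, hx, fun j k l => ?_⟩
  have hsplit : B j k l - ⟪x k, (A + G) j (x l)⟫_ℂ =
      (B j k l - ⟪x k, (A + F) j (x l)⟫_ℂ) - ⟪x k, (G j - F j) (x l)⟫_ℂ := by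
    simp only [Pi.add_apply, add_apply, sub_apply, inner_add_right, inner_sub_right]
    ring
  have hle : ‖⟪x k, (G j - F j) (x l)⟫_ℂ‖ ≤ ε / 2 := by
    refine (norm_inner_le_norm _ _).trans ?_
    rw [hx.1 k, one_mul]
    refine ((G j - F j).le_opNorm _).trans ?_
    rw [hx.1 l, mul_one]
    exact hGF j
  rw [hsplit]
  linarith [norm_sub_le (B j k l - ⟪x k, (A + F) j (x l)⟫_ℂ) ⟪x k, (G j - F j) (x l)⟫_ℂ,
    hBx j k l]

/-- An orthonormal family can be moved into the orthogonal complement of a finite-dimensional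
subspace `K` so that the compressions of the operators `replaceCorner K (y j) (A j)` become
approximate compressions of the `A j`. -/
theorem exists_orthonormal_mem_orthogonal {m q : ℕ} {A : Fin m → (H →L[ℂ] H)}
    (hA : ∀ j, IsSelfAdjoint (A j)) {y : Fin m → ℝ}
    (hy : ∀ L : Submodule ℂ H, FiniteDimensional ℂ L → ∀ ε > 0,
      ∃ x ∈ Lᗮ, ‖x‖ = 1 ∧ ∀ j, |(⟪x, A j x⟫_ℂ).re - y j| < ε)
    (K : Submodule ℂ H) [FiniteDimensional ℂ K] {x : Fin q → H} (hx : Orthonormal ℂ x)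
    {ε : ℝ} (hε : 0 < ε) :
    ∃ z : Fin q → H, Orthonormal ℂ z ∧ (∀ k, z k ∈ Kᗮ) ∧ ∀ j k l,
      ‖⟪x k, replaceCorner K (y j) (A j) (x l)⟫_ℂ - ⟪z k, A j (z l)⟫_ℂ‖ < ε := by
  let b := stdOrthonormalBasis ℂ K
  let N := Module.finrank ℂ K
  let u (k : Fin q) : H := x k - K.starProjection (x k)
  have hu (k) : u k ∈ Kᗮ := K.sub_starProjection_mem_orthogonal (x k)
  let t : Set H := Set.range u ∪ ⋃ j, Set.range fun k => A j (u k)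
  have ht : t.Finite :=
    (Set.finite_range u).union (Set.finite_iUnion fun j => Set.finite_range _)
  have := FiniteDimensional.span_of_finite ℂ ht
  -- At most `N` errors of size `ε / (N + 1)` are summed below; the `+ 1` keeps the bound strict and
  -- covers `N = 0`.
  obtain ⟨f, hf, hfL, hfA, hfd⟩ := exists_orthonormal_diagonal hA hy (K ⊔ Submodule.span ℂ t)
    (show 0 < ε / (N + 1) by positivity)
  have hft (w) (hw : w ∈ t) (n) : ⟪w, f n⟫_ℂ = 0 :=
    (Submodule.mem_orthogonal _ _).1 (hfL n) w
      (le_sup_right (a := K) (Submodule.subset_span hw))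
  have hfK (n) : f n ∈ Kᗮ := Submodule.orthogonal_le le_sup_left (hfL n)
  have huf (k n) : ⟪u k, f n⟫_ℂ = 0 := hft _ (Or.inl ⟨k, rfl⟩) n
  have hAuf (j k n) : ⟪A j (u k), f n⟫_ℂ = 0 :=
    hft _ (Or.inr (Set.mem_iUnion.2 ⟨j, k, rfl⟩)) n
  have huAf (j k n) : ⟪u k, A j (f n)⟫_ℂ = 0 := by
    rw [← hAuf j k n]
    exact ((hA j).isSymmetric (u k) (f n)).symm
  let c (k : Fin q) (i : Fin N) : ℂ := ⟪(b i : H), x k⟫_ℂ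
  have hc (k i) : ‖c k i‖ ≤ 1 := by
    refine (norm_inner_le_norm _ _).trans ?_
    rw [hx.1 k, mul_one]
    exact (b.orthonormal.1 i).le
  have hcc (k l) : ⟪K.starProjection (x k), K.starProjection (x l)⟫_ℂ =
      ∑ i, conj (c k i) * c l i := by
    have h := b.sum_inner_mul_inner (K.orthogonalProjectionOnto (x k))
      (K.orthogonalProjectionOnto (x l))
    refine h.symm.trans (Finset.sum_congr rfl fun i _ => ?_)
    have hci (k) : ⟪b i, K.orthogonalProjectionOnto (x k)⟫_ℂ = c k i :=
      K.inner_orthogonalProjectionOnto_eq_of_mem_left (b i) (x k)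
    rw [hci, ← hci k, inner_conj_symm]
  -- `w k` carries the coordinates of `P (x k)` over to the `f i`, so the Gram matrix is unchanged
  -- and `u k + w k` is again orthonormal.
  let w (k : Fin q) : H := ∑ i, c k i • f i
  have huw (k l) : ⟪u k, w l⟫_ℂ = 0 := by
    simp [w, huf]
  have huAw (j k l) : ⟪u k, A j (w l)⟫_ℂ = 0 := by
    simp [w, huAf]
  have hwAu (j k l) : ⟪w k, A j (u l)⟫_ℂ = 0 := by
    refine ((hA j).isSymmetric (w k) (u l)).symm.trans (inner_eq_zero_symm.1 ?_)
    exact huAw j l k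
  have hww (k l) : ⟪w k, w l⟫_ℂ = ∑ i, conj (c k i) * c l i := by
    have horth := orthonormal_iff_ite.1 hf
    simp only [w, sum_inner, inner_sum, inner_smul_left, inner_smul_right, horth, Fin.val_inj]
    simp [mul_comm]
  have hwAw (j k l) : ⟪w k, A j (w l)⟫_ℂ =
      ∑ i : Fin N, conj (c k i) * c l i * ⟪f i, A j (f i)⟫_ℂ := by
    simp only [w, map_sum, map_smul, sum_inner, inner_sum, inner_smul_left, inner_smul_right]
    refine Finset.sum_congr rfl fun i _ => ?_
    rw [Finset.sum_eq_single i]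
    · ring
    · intro n _ hn
      rw [hfd j n i fun h => hn (Fin.val_injective h)]
      ring
    · simp
  refine ⟨fun k => u k + w k, ?_, fun k => ?_, fun j k l => ?_⟩
  · rw [orthonormal_iff_ite]
    intro k l
    have hdecomp : ⟪x k, x l⟫_ℂ =
        ⟪u k, u l⟫_ℂ + ⟪K.starProjection (x k), K.starProjection (x l)⟫_ℂ := by
      have h₁ := Submodule.inner_left_of_mem_orthogonal
        (K.starProjection_apply_mem (x l)) (hu k)
      have h₂ := Submodule.inner_right_of_mem_orthogonal
        (K.starProjection_apply_mem (x k)) (hu l)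
      have hxu (k) : x k = u k + K.starProjection (x k) := (sub_add_cancel _ _).symm
      conv_lhs => rw [hxu k, hxu l, inner_add_left, inner_add_right, inner_add_right, h₁, h₂]
      ring
    rw [← orthonormal_iff_ite.1 hx k l, hdecomp, hcc, ← hww, inner_add_left, inner_add_right,
      inner_add_right, huw, inner_eq_zero_symm.1 (huw l k)]
    ring
  · exact Kᗮ.add_mem (hu k) (Kᗮ.sum_mem fun i _ => Kᗮ.smul_mem _ (hfK i))
  -- The cross terms between `u` and `w` vanish, leaving only the deviation of the diagonal values
  -- from `y j`.
  · have hdiff : ⟪x k, replaceCorner K (y j) (A j) (x l)⟫_ℂ - ⟪u k + w k, A j (u l + w l)⟫_ℂ =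
        -∑ i : Fin N, conj (c k i) * c l i * (⟪f i, A j (f i)⟫_ℂ - y j) := by
      rw [inner_replaceCorner, hcc, map_add, inner_add_left, inner_add_right, inner_add_right,
        huAw, hwAu, hwAw]
      simp only [mul_sub, Finset.sum_sub_distrib, Finset.mul_sum]
      simp only [mul_comm (y j : ℂ)]
      ring
    have hterm (i : Fin N) :
        ‖conj (c k i) * c l i * (⟪f i, A j (f i)⟫_ℂ - y j)‖ ≤ ε / (N + 1) := by
      rw [norm_mul, norm_mul, RCLike.norm_conj]
      refine (mul_le_of_le_one_left (norm_nonneg _) ?_).trans (hfA i j).le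
      exact mul_le_one₀ (hc k i) (norm_nonneg _) (hc l i)
    rw [hdiff, norm_neg]
    calc _ ≤ ∑ _i : Fin N, ε / (N + 1) := norm_sum_le_of_le _ fun i _ => hterm i
      _ = N * ε / (N + 1) := by simp [mul_div_assoc]
      _ < ε := by
        rw [div_lt_iff₀ (by positivity)]
        nlinarith

/-! ### From compact self-adjoint to finite rank perturbations -/

theorem iInter_closure_jointRange_subset (hH : ¬ FiniteDimensional ℂ H) {m : ℕ} (q : ℕ)
    {A : Fin m → (H →L[ℂ] H)} (hA : ∀ j, IsSelfAdjoint (A j)) {F : Fin m → (H →L[ℂ] H)}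
    (hF : ∀ j, (F j).toLinearMap.HasFiniteRange) :
    ⋂ G ∈ {G : Fin m → (H →L[ℂ] H) | ∀ j, IsSelfAdjoint (G j) ∧ IsCompactOperator (G j)},
      closure (jointRange q (A + G)) ⊆ closure (jointRange q (A + F)) := by
  intro B hB
  obtain ⟨y, hy⟩ := exists_essential_point hH A
  let K : Submodule ℂ H := ⨆ j, (F j).toLinearMap.range
  have hfin (j : Fin m) : FiniteDimensional ℂ (F j).toLinearMap.range := Module.Finite.iff_fg.2 (hF j).fg_range
  have : FiniteDimensional ℂ K := Submodule.finiteDimensional_iSup _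
  have hFK (j) (v : H) : F j v ∈ K :=
    le_iSup (fun j => (F j).toLinearMap.range) j ⟨v, rfl⟩
  have hG := Set.mem_iInter₂.1 hB (fun j => replaceCorner K (y j) (A j) - A j) fun j =>
    ⟨(isSelfAdjoint_replaceCorner K (y j) (hA j)).sub (hA j),
      isCompactOperator_replaceCorner_sub K (y j) (A j)⟩
  rw [mem_closure_jointRange_iff] at hG ⊢
  intro ε hε
  obtain ⟨x, hx, hBx⟩ := hG _ (half_pos hε)
  obtain ⟨z, hz, hzK, hxz⟩ := exists_orthonormal_mem_orthogonal hA hy K hx (half_pos hε)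
  refine ⟨z, hz, fun j k l => ?_⟩
  -- Only the left vector `z k` needs to be orthogonal to the range of `F j`, so `F j` need not be
  -- self-adjoint.
  have hzF : ⟪z k, (A + F) j (z l)⟫_ℂ = ⟪z k, A j (z l)⟫_ℂ := by
    rw [Pi.add_apply, add_apply, inner_add_right,
      Submodule.inner_left_of_mem_orthogonal (hFK j (z l)) (hzK k), add_zero]
  have hB' := hBx j k l
  rw [Pi.add_apply, add_sub_cancel] at hB'
  rw [hzF]
  linarith [norm_sub_le_norm_sub_add_norm_sub (B j k l)
    ⟪x k, replaceCorner K (y j) (A j) (x l)⟫_ℂ ⟪z k, A j (z l)⟫_ℂ, hxz j k l]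

end

end MatricialRange

theorem proposition4p5 {H : Type*} [NormedAddCommGroup H] [InnerProductSpace ℂ H]
    [CompleteSpace H] (hH : ¬ FiniteDimensional ℂ H) {m q : ℕ} (hq : 0 < q)
    (A : Fin m → (H →L[ℂ] H)) (hA : ∀ j, IsSelfAdjoint (A j)) :
    MatricialRange.essRange q A =
      ⋂ G ∈ {G : Fin m → (H →L[ℂ] H) | ∀ j, IsSelfAdjoint (G j) ∧ IsCompactOperator (G j)},
        closure (MatricialRange.jointRange q (A + G)) := by
  refine Set.Subset.antisymm ?_ ?_
  · exact Set.subset_iInter₂ fun G hG =>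
      MatricialRange.essRange_subset q A fun j => (hG j).2
  · exact Set.subset_iInter₂ fun F hF =>
      MatricialRange.iInter_closure_jointRange_subset hH q hA hF
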